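/- **Theorem 3.1.** Let $M$ be a smooth manifold of dimension $2n+1$, and let $(\varphi,\xi,\eta,g)$ be a paracontact metric structure on $M$. That is, $\varphi$ is a smooth $(1,1)$-tensor field, $\xi$ a smooth vector field, $\eta$ a smooth $1$-form and $g$ a semi-Riemannian metric with $$\eta(\xi)=1,\qquad \varphi^2=I-\eta\otimes\xi,$$ the eigendistributions of $\varphi$ for the eigenvalues $1$ and $-1$ both have dimension $n$, $$g(\varphi X,\varphi Y)=-g(X,Y)+\eta(X)\eta(Y),\qquad d\eta(X,Y)=g(X,\varphi Y)$$ for all smooth vector fields $X,Y$, where $d\eta(X,Y)=\tfrac12\big(X\eta(Y)-Y\eta(X)-\eta([X,Y])\big)$. Let $\nabla$ be the Levi-Civita connection of $g$, $R(X,Y)Z=\nabla_X\nabla_YZ-\nabla_Y\nabla_XZ-\nabla_{[X,Y]}Z$, and $h=\tfrac12 L_\xi\varphi$. Assume that $$R(X,Y)\xi=-(\eta(Y)X-\eta(X)Y)\qquad\text{for all smooth vector fields }X,Y.$$ Then $M$ is paraSasakian, i.e. $$\varphi^2[X,Y]+[\varphi X,\varphi Y]-\varphi[\varphi X,Y]-\varphi[X,\varphi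 Y]-2\,d\eta(X,Y)\,\xi=0\qquad\text{for all smooth vector fields }X,Y,$$ if and only if $\xi$ is a Killing vector field, i.e. $L_\xi g=0$. Moreover, $\xi$ is a Killing vector field if and only if $h=0$. -/

import Mathlib

open Bundle VectorField
open scoped Manifold ContDiff

noncomputable section

namespace ParacontactGeometry

section SemiRiemannian

variable {m : ℕ} {M : Type*} [TopologicalSpace M] [ChartedSpace (EuclideanSpace ℝ (Fin m)) M]

/-- The derivative `X f` of a function along a vector field. -/
def dirDeriv (X : Π x : M, TangentSpace (𝓡 m) x) (f : M → ℝ) (x : M) : ℝ :=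
  mvfderiv (𝓡 m) f x (X x)

variable [IsManifold (𝓡 m) ∞ M]

/-- Smooth (globally defined) vector fields on `M`. -/
def IsSmoothField (X : Π x : M, TangentSpace (𝓡 m) x) : Prop :=
  ContMDiff (𝓡 m) (𝓡 m).tangent ∞ (fun x ↦ (⟨x, X x⟩ : TangentBundle (𝓡 m) M))

variable (m M) in
/-- A semi-Riemannian metric on the `m`-dimensional smooth manifold `M`: a smooth field of
symmetric nondegenerate bilinear forms on the tangent spaces. (The index is locally constant; for
the metrics of paracontact geometry below it equals `n` at every point.) -/
structure SemiRiemannianMetric where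
  inner (x : M) : TangentSpace (𝓡 m) x →L[ℝ] TangentSpace (𝓡 m) x →L[ℝ] ℝ
  symm (x : M) (v w : TangentSpace (𝓡 m) x) : inner x v w = inner x w v
  nondegenerate (x : M) (v : TangentSpace (𝓡 m) x) : (∀ w, inner x v w = 0) → v = 0
  contMDiff : ContMDiff (𝓡 m)
    ((𝓡 m).prod 𝓘(ℝ, EuclideanSpace ℝ (Fin m) →L[ℝ] EuclideanSpace ℝ (Fin m) →L[ℝ] ℝ)) ∞
    (fun x ↦ TotalSpace.mk' (EuclideanSpace ℝ (Fin m) →L[ℝ] EuclideanSpace ℝ (Fin m) →L[ℝ] ℝ)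
      (E := fun x : M ↦ TangentSpace (𝓡 m) x →L[ℝ] TangentSpace (𝓡 m) x →L[ℝ] ℝ) x (inner x))

namespace SemiRiemannianMetric

variable (g : SemiRiemannianMetric m M)

/-- The right hand side of the Koszul formula for `2 g(∇_X Y, Z)`. -/
def koszul (X Y Z : Π x : M, TangentSpace (𝓡 m) x) (x : M) : ℝ :=
  dirDeriv X (fun y ↦ g.inner y (Y y) (Z y)) x
    + dirDeriv Y (fun y ↦ g.inner y (Z y) (X y)) x
    - dirDeriv Z (fun y ↦ g.inner y (X y) (Y y)) x
    + g.inner x (mlieBracket (𝓡 m) X Y x) (Z x)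
    - g.inner x (mlieBracket (𝓡 m) Y Z x) (X x)
    + g.inner x (mlieBracket (𝓡 m) Z X x) (Y x)

/-- The Levi-Civita connection `∇_X Y` of the metric `g`: at each point `x`, it is the tangent
vector determined by the Koszul formula. -/
def leviCivita (X Y : Π x : M, TangentSpace (𝓡 m) x) (x : M) : TangentSpace (𝓡 m) x :=
  Classical.epsilon fun w ↦ ∀ Z : Π x : M, TangentSpace (𝓡 m) x,
    MDifferentiableAt (𝓡 m) (𝓡 m).tangent (fun y ↦ (⟨y, Z y⟩ : TangentBundle (𝓡 m) M)) x →
      2 * g.inner x w (Z x) = g.koszul X Y Z x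

/-- The curvature `R(X, Y) Z = ∇_X ∇_Y Z - ∇_Y ∇_X Z - ∇_{[X, Y]} Z`. -/
def curvature (X Y Z : Π x : M, TangentSpace (𝓡 m) x) (x : M) : TangentSpace (𝓡 m) x :=
  g.leviCivita X (g.leviCivita Y Z) x - g.leviCivita Y (g.leviCivita X Z) x
    - g.leviCivita (mlieBracket (𝓡 m) X Y) Z x

/-- `ξ` is a Killing vector field: `L_ξ g = 0`. -/
def IsKilling (ξ : Π x : M, TangentSpace (𝓡 m) x) : Prop :=
  ∀ X Y : Π x : M, TangentSpace (𝓡 m) x, IsSmoothField X → IsSmoothField Y → ∀ x,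
    dirDeriv ξ (fun y ↦ g.inner y (X y) (Y y)) x
      - g.inner x (mlieBracket (𝓡 m) ξ X x) (Y x)
      - g.inner x (X x) (mlieBracket (𝓡 m) ξ Y x) = 0

lemma mdifferentiableAt_inner {X Y : Π x : M, TangentSpace (𝓡 m) x} {x : M}
    (hX : MDifferentiableAt (𝓡 m) (𝓡 m).tangent
      (fun y ↦ (⟨y, X y⟩ : TangentBundle (𝓡 m) M)) x)
    (hY : MDifferentiableAt (𝓡 m) (𝓡 m).tangent
      (fun y ↦ (⟨y, Y y⟩ : TangentBundle (𝓡 m) M)) x) :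
    MDifferentiableAt (𝓡 m) 𝓘(ℝ) (fun y ↦ g.inner y (X y) (Y y)) x := by
  have h : MDifferentiableAt (𝓡 m) ((𝓡 m).prod 𝓘(ℝ))
      (fun y ↦ TotalSpace.mk' ℝ (E := Bundle.Trivial M ℝ) y (g.inner y (X y) (Y y))) x := by
    apply MDifferentiableAt.clm_bundle_apply₂ (F₁ := EuclideanSpace ℝ (Fin m))
      (F₂ := EuclideanSpace ℝ (Fin m))
    · exact (g.contMDiff x).mdifferentiableAt (by simp)
    · exact hX
    · exact hY
  simp only [mdifferentiableAt_totalSpace] at h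
  exact h.2

/-- The Koszul expression is tensorial in its last argument. -/
lemma koszul_tensorialAt {X Y : Π x : M, TangentSpace (𝓡 m) x} {x : M}
    (hX : MDifferentiableAt (𝓡 m) (𝓡 m).tangent
      (fun y ↦ (⟨y, X y⟩ : TangentBundle (𝓡 m) M)) x)
    (hY : MDifferentiableAt (𝓡 m) (𝓡 m).tangent
      (fun y ↦ (⟨y, Y y⟩ : TangentBundle (𝓡 m) M)) x) :
    TensorialAt (𝓡 m) (EuclideanSpace ℝ (Fin m)) (fun Z ↦ g.koszul X Y Z x) x where
  smul {f Z} hf hZ := by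
    have h1 := mvfderiv_mul hf (g.mdifferentiableAt_inner hY hZ)
    have h2 := mvfderiv_mul hf (g.mdifferentiableAt_inner hZ hX)
    have e1 : (fun y ↦ g.inner y (Y y) ((f • Z) y)) = f * fun y ↦ g.inner y (Y y) (Z y) := by
      ext y; simp
    have e2 : (fun y ↦ g.inner y ((f • Z) y) (X y)) = f * fun y ↦ g.inner y (Z y) (X y) := by
      ext y; simp
    simp only [koszul, dirDeriv]
    rw [e1, e2, h1, h2, mlieBracket_smul_left hf hZ, mlieBracket_smul_right hf hZ]
    simp [g.symm x (Z x)]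
    ring
  add {Z Z'} hZ hZ' := by
    have h1 := mvfderiv_add (g.mdifferentiableAt_inner hY hZ) (g.mdifferentiableAt_inner hY hZ')
    have h2 := mvfderiv_add (g.mdifferentiableAt_inner hZ hX) (g.mdifferentiableAt_inner hZ' hX)
    have e1 : (fun y ↦ g.inner y (Y y) ((Z + Z') y))
        = (fun y ↦ g.inner y (Y y) (Z y)) + fun y ↦ g.inner y (Y y) (Z' y) := by
      ext y; simp
    have e2 : (fun y ↦ g.inner y ((Z + Z') y) (X y))
        = (fun y ↦ g.inner y (Z y) (X y)) + fun y ↦ g.inner y (Z' y) (X y) := by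
      ext y; simp
    simp only [koszul, dirDeriv]
    rw [e1, e2, h1, h2, mlieBracket_add_left hZ hZ', mlieBracket_add_right hZ hZ']
    simp
    ring

/-- The Levi-Civita connection is well defined: it satisfies the Koszul formula. (The vector is
unique since `g` is nondegenerate.) -/
theorem two_mul_inner_leviCivita {X Y Z : Π x : M, TangentSpace (𝓡 m) x} {x : M}
    (hX : MDifferentiableAt (𝓡 m) (𝓡 m).tangent
      (fun y ↦ (⟨y, X y⟩ : TangentBundle (𝓡 m) M)) x)
    (hY : MDifferentiableAt (𝓡 m) (𝓡 m).tangent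
      (fun y ↦ (⟨y, Y y⟩ : TangentBundle (𝓡 m) M)) x)
    (hZ : MDifferentiableAt (𝓡 m) (𝓡 m).tangent
      (fun y ↦ (⟨y, Z y⟩ : TangentBundle (𝓡 m) M)) x) :
    2 * g.inner x (g.leviCivita X Y x) (Z x) = g.koszul X Y Z x := by
  have hT := g.koszul_tensorialAt hX hY
  have hex : ∃ w : TangentSpace (𝓡 m) x, ∀ Z : Π x : M, TangentSpace (𝓡 m) x,
      MDifferentiableAt (𝓡 m) (𝓡 m).tangent (fun y ↦ (⟨y, Z y⟩ : TangentBundle (𝓡 m) M)) x →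
        2 * g.inner x w (Z x) = g.koszul X Y Z x := by
    have : FiniteDimensional ℝ (TangentSpace (𝓡 m) x) :=
      inferInstanceAs (FiniteDimensional ℝ (EuclideanSpace ℝ (Fin m)))
    let G : TangentSpace (𝓡 m) x →ₗ[ℝ] Module.Dual ℝ (TangentSpace (𝓡 m) x) :=
      { toFun := fun v ↦ (g.inner x v).toLinearMap
        map_add' := fun v w ↦ by ext; simp
        map_smul' := fun c v ↦ by ext; simp }
    have hinj : Function.Injective G := by
      rw [← LinearMap.ker_eq_bot, LinearMap.ker_eq_bot']
      intro v hv
      exact g.nondegenerate x v fun w ↦ by simpa [G] using DFunLike.congr_fun hv w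
    have hsurj : Function.Surjective G :=
      (LinearMap.injective_iff_surjective_of_finrank_eq_finrank
        (Subspace.dual_finrank_eq).symm).1 hinj
    obtain ⟨w, hw⟩ := hsurj (TensorialAt.mkHom _ x hT).toLinearMap
    refine ⟨(1 / 2 : ℝ) • w, fun Z hZ ↦ ?_⟩
    have h1 : g.inner x w (Z x) = TensorialAt.mkHom _ x hT (Z x) := DFunLike.congr_fun hw (Z x)
    rw [TensorialAt.mkHom_apply hT hZ] at h1
    simp [h1]
  exact Classical.epsilon_spec hex Z hZ

end SemiRiemannianMetric

end SemiRiemannian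

section Paracontact

variable (n : ℕ) (M : Type*) [TopologicalSpace M]
  [ChartedSpace (EuclideanSpace ℝ (Fin (2 * n + 1))) M] [IsManifold (𝓡 (2 * n + 1)) ∞ M]

/-- An almost paracontact structure `(φ, ξ, η)` on the `(2n+1)`-dimensional manifold `M`. -/
structure AlmostParacontactStructure where
  φ (x : M) : TangentSpace (𝓡 (2 * n + 1)) x →L[ℝ] TangentSpace (𝓡 (2 * n + 1)) x
  ξ (x : M) : TangentSpace (𝓡 (2 * n + 1)) x
  η (x : M) : TangentSpace (𝓡 (2 * n + 1)) x →L[ℝ] ℝ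
  contMDiff_φ : ContMDiff (𝓡 (2 * n + 1)) ((𝓡 (2 * n + 1)).prod
      𝓘(ℝ, EuclideanSpace ℝ (Fin (2 * n + 1)) →L[ℝ] EuclideanSpace ℝ (Fin (2 * n + 1)))) ∞
    (fun x ↦ TotalSpace.mk'
      (EuclideanSpace ℝ (Fin (2 * n + 1)) →L[ℝ] EuclideanSpace ℝ (Fin (2 * n + 1)))
      (E := fun x : M ↦
        TangentSpace (𝓡 (2 * n + 1)) x →L[ℝ] TangentSpace (𝓡 (2 * n + 1)) x) x (φ x))
  contMDiff_ξ : IsSmoothField ξ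
  contMDiff_η : ContMDiff (𝓡 (2 * n + 1)) ((𝓡 (2 * n + 1)).prod
      𝓘(ℝ, EuclideanSpace ℝ (Fin (2 * n + 1)) →L[ℝ] ℝ)) ∞
    (fun x ↦ TotalSpace.mk' (EuclideanSpace ℝ (Fin (2 * n + 1)) →L[ℝ] ℝ)
      (E := fun x : M ↦ TangentSpace (𝓡 (2 * n + 1)) x →L[ℝ] Bundle.Trivial M ℝ x) x (η x))
  η_ξ (x : M) : η x (ξ x) = 1
  φ_φ (x : M) (v : TangentSpace (𝓡 (2 * n + 1)) x) : φ x (φ x v) = v - η x v • ξ x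
  finrank_pos (x : M) : Module.finrank ℝ (Module.End.eigenspace (φ x).toLinearMap (1 : ℝ)) = n
  finrank_neg (x : M) : Module.finrank ℝ (Module.End.eigenspace (φ x).toLinearMap (-1 : ℝ)) = n

variable {n M}

namespace AlmostParacontactStructure

variable (S : AlmostParacontactStructure n M)

/-- The vector field `φ X`. -/
def phi (X : Π x : M, TangentSpace (𝓡 (2 * n + 1)) x) (x : M) : TangentSpace (𝓡 (2 * n + 1)) x :=
  S.φ x (X x)

/-- The exterior derivative of `η`, in the normalization
`dη(X, Y) = (X (η Y) - Y (η X) - η [X, Y]) / 2` that is used in paracontact geometry. -/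
def dη (X Y : Π x : M, TangentSpace (𝓡 (2 * n + 1)) x) (x : M) : ℝ :=
  (dirDeriv X (fun y ↦ S.η y (Y y)) x - dirDeriv Y (fun y ↦ S.η y (X y)) x
    - S.η x (mlieBracket (𝓡 (2 * n + 1)) X Y x)) / 2

/-- The Nijenhuis tensor of `φ`. -/
def nijenhuis (X Y : Π x : M, TangentSpace (𝓡 (2 * n + 1)) x) (x : M) :
    TangentSpace (𝓡 (2 * n + 1)) x :=
  S.φ x (S.φ x (mlieBracket (𝓡 (2 * n + 1)) X Y x))
    + mlieBracket (𝓡 (2 * n + 1)) (S.phi X) (S.phi Y) x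
    - S.φ x (mlieBracket (𝓡 (2 * n + 1)) (S.phi X) Y x)
    - S.φ x (mlieBracket (𝓡 (2 * n + 1)) X (S.phi Y) x)

/-- Normality: the tensor `N_φ - 2 dη ⊗ ξ` vanishes identically. -/
def IsNormal : Prop :=
  ∀ X Y : Π x : M, TangentSpace (𝓡 (2 * n + 1)) x, IsSmoothField X → IsSmoothField Y → ∀ x,
    S.nijenhuis X Y x - (2 * S.dη X Y x) • S.ξ x = 0

/-- The tensor `h = (1/2) L_ξ φ`, that is, `h X = ([ξ, φ X] - φ [ξ, X]) / 2`. -/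
def h (X : Π x : M, TangentSpace (𝓡 (2 * n + 1)) x) (x : M) : TangentSpace (𝓡 (2 * n + 1)) x :=
  (1 / 2 : ℝ) • (mlieBracket (𝓡 (2 * n + 1)) S.ξ (S.phi X) x
    - S.φ x (mlieBracket (𝓡 (2 * n + 1)) S.ξ X x))

end AlmostParacontactStructure

variable (n M) in
/-- A paracontact metric structure `(φ, ξ, η, g)` on the `(2n+1)`-dimensional manifold `M`: an
almost paracontact structure with a compatible semi-Riemannian metric `g` such that
`dη(X, Y) = g(X, φ Y)`. -/
structure ParacontactMetricStructure extends AlmostParacontactStructure n M where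
  g : SemiRiemannianMetric (2 * n + 1) M
  compatible (x : M) (v w : TangentSpace (𝓡 (2 * n + 1)) x) :
    g.inner x (φ x v) (φ x w) = -g.inner x v w + η x v * η x w
  dη_eq (X Y : Π x : M, TangentSpace (𝓡 (2 * n + 1)) x) (hX : IsSmoothField X)
    (hY : IsSmoothField Y) (x : M) :
    toAlmostParacontactStructure.dη X Y x = g.inner x (X x) (φ x (Y x))

/-- A paraSasakian manifold is a normal paracontact metric manifold. -/
def ParacontactMetricStructure.IsParaSasakian (S : ParacontactMetricStructure n M) : Prop :=
  S.toAlmostParacontactStructure.IsNormal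

end Paracontact

end ParacontactGeometry

end

/-! All three conditions are compared through `h`. Since `dη` is exact and `L_ξ η = 0`, also `L_ξ dη
= 0`; as `dη(X, Y) = g(X, φY)`, this gives `(L_ξ g)(X, φY) = -2 g(X, hY)` (`lieDeriv_inner_phi`).
With `φ² = I - η ⊗ ξ`, it follows that `ξ` is Killing exactly when `h = 0`. Normality evaluated on
`(ξ, X)` gives `φ(hX) = 0`, hence `h = 0`.

The curvature assumption serves the step from Killing to paraSasakian. For Killing `ξ`, `∇ξ = -φ`
(`leviCivita_ξ`), so `R(X, Y)ξ` is the antisymmetrization of `∇φ`, up to sign. As `∇_X φ` is skew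
for `g`, this antisymmetrization determines `∇φ` (`leviCivita_phi`), and normality is then a
computation. -/

namespace ParacontactGeometry

section SemiRiemannian

variable {m : ℕ} {M : Type*} [TopologicalSpace M] [ChartedSpace (EuclideanSpace ℝ (Fin m)) M]

/-! ### Vector fields as derivations; global extensions of tangent vectors. -/

section Calculus

variable {X Y Z : Π x : M, TangentSpace (𝓡 m) x} {f f' : M → ℝ}

lemma dirDeriv_add (x : M) (hf : MDifferentiableAt (𝓡 m) 𝓘(ℝ) f x)
    (hf' : MDifferentiableAt (𝓡 m) 𝓘(ℝ) f' x) :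
    dirDeriv X (f + f') x = dirDeriv X f x + dirDeriv X f' x := by
  simp [dirDeriv, mvfderiv_add hf hf']

lemma dirDeriv_sub (x : M) (hf : MDifferentiableAt (𝓡 m) 𝓘(ℝ) f x)
    (hf' : MDifferentiableAt (𝓡 m) 𝓘(ℝ) f' x) :
    dirDeriv X (f - f') x = dirDeriv X f x - dirDeriv X f' x := by
  simp [dirDeriv, mvfderiv_sub hf hf']

lemma dirDeriv_neg (x : M) : dirDeriv X (-f) x = -dirDeriv X f x := by
  simp [dirDeriv]

lemma dirDeriv_const (c : ℝ) (x : M) : dirDeriv X (fun _ ↦ c) x = 0 := by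
  simp [dirDeriv, mvfderiv_const]

variable [IsManifold (𝓡 m) ∞ M]

lemma IsSmoothField.mdifferentiableAt (hX : IsSmoothField X) (x : M) :
    MDifferentiableAt (𝓡 m) (𝓡 m).tangent (fun y ↦ (⟨y, X y⟩ : TangentBundle (𝓡 m) M)) x :=
  (hX x).mdifferentiableAt (by simp)

lemma IsSmoothField.neg (hX : IsSmoothField X) : IsSmoothField (-X) :=
  ContMDiff.neg_section hX

lemma IsSmoothField.smul (hf : ContMDiff (𝓡 m) 𝓘(ℝ) ∞ f) (hX : IsSmoothField X) :
    IsSmoothField (f • X) :=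
  ContMDiff.smul_section hf hX

lemma IsSmoothField.mlieBracket (hX : IsSmoothField X) (hY : IsSmoothField Y) :
    IsSmoothField (mlieBracket (𝓡 m) X Y) := fun x ↦
  have : IsManifold (𝓡 m) (minSmoothness ℝ 2) M :=
    .of_le (n := ∞) (by simpa using ENat.LEInfty.out)
  -- `∞ + 1` is `∞` by definition, so the bracket loses no smoothness.
  have : IsManifold (𝓡 m) ((⊤ : ℕ∞) + 1) M := ‹IsManifold (𝓡 m) ∞ M›
  ContMDiffAt.mlieBracket_vectorField (m := ⊤) (n := ⊤) (hX x) (hY x) (by simp)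

lemma contMDiff_dirDeriv (hX : IsSmoothField X) (hf : ContMDiff (𝓡 m) 𝓘(ℝ) ∞ f) :
    ContMDiff (𝓡 m) 𝓘(ℝ) ∞ (dirDeriv X f) := by
  have h : ContMDiff (𝓡 m) 𝓘(ℝ).tangent ∞
      (fun x ↦ tangentMap (𝓡 m) 𝓘(ℝ) f (⟨x, X x⟩ : TangentBundle (𝓡 m) M)) :=
    (hf.contMDiff_tangentMap (m := ∞) (by simp)).comp hX
  exact (contMDiff_snd_tangentBundle_modelSpace ℝ 𝓘(ℝ)).comp h

/-- Every tangent vector of a Hausdorff manifold extends to a global smooth vector field. -/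
lemma exists_isSmoothField_eq [T2Space M] (x : M) (v : TangentSpace (𝓡 m) x) :
    ∃ X : Π x : M, TangentSpace (𝓡 m) x, IsSmoothField X ∧ X x = v := by
  let E := EuclideanSpace ℝ (Fin m)
  obtain ⟨s, hs, hsX⟩ := FiberBundle.exists_contMDiffOn_extend (k := ∞) (𝓡 m) E
    (V := fun x : M ↦ TangentSpace (𝓡 m) x) v
  obtain ⟨u, hus, hu, hxu⟩ := mem_nhds_iff.1 hs
  obtain ⟨ψ, -, hψ⟩ := (SmoothBumpFunction.nhds_basis_tsupport (I := 𝓡 m) x).mem_iff.1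
    (hu.mem_nhds hxu)
  refine ⟨(ψ : M → ℝ) • FiberBundle.extend E v, fun y ↦ ?_, by simp⟩
  have := ContMDiffOn.smul_section_of_tsupport (u := u) (𝕜 := ℝ) (ψ.contMDiff.contMDiffOn) hu hψ
    (hsX.mono hus)
  exact this y

lemma leibniz_identity_mlieBracket_field (hX : IsSmoothField X) (hY : IsSmoothField Y)
    (hZ : IsSmoothField Z) (x : M) :
    mlieBracket (𝓡 m) X (mlieBracket (𝓡 m) Y Z) x =
      mlieBracket (𝓡 m) (mlieBracket (𝓡 m) X Y) Z x
        + mlieBracket (𝓡 m) Y (mlieBracket (𝓡 m) X Z) x := by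
  have : IsManifold (𝓡 m) (minSmoothness ℝ 3) M :=
    .of_le (n := ∞) (by simpa using ENat.LEInfty.out)
  have h2 : minSmoothness ℝ 2 ≤ ∞ := by simpa using ENat.LEInfty.out
  exact leibniz_identity_mlieBracket_apply ((hX x).of_le h2) ((hY x).of_le h2) ((hZ x).of_le h2)

/-- The Lie bracket acts on functions as the commutator. -/
lemma dirDeriv_mlieBracket [T2Space M] (hX : IsSmoothField X) (hY : IsSmoothField Y)
    (hf : ContMDiff (𝓡 m) 𝓘(ℝ) ∞ f) (x : M) :
    dirDeriv (mlieBracket (𝓡 m) X Y) f x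
      = dirDeriv X (dirDeriv Y f) x - dirDeriv Y (dirDeriv X f) x := by
  have smulr {V W : Π x : M, TangentSpace (𝓡 m) x} {f : M → ℝ} (hW : IsSmoothField W)
      (hf : ContMDiff (𝓡 m) 𝓘(ℝ) ∞ f) :
      mlieBracket (𝓡 m) V (f • W) = dirDeriv V f • W + f • mlieBracket (𝓡 m) V W := by
    ext1 y
    exact mlieBracket_smul_right ((hf y).mdifferentiableAt (by simp)) (hW.mdifferentiableAt y)
  -- Expand the Jacobi identity for `X, Y, fW` and subtract `f` times the one for `X, Y, W`: the
  -- mixed first-order terms cancel, leaving the defect of the commutator formula times `W`.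
  have key (v : TangentSpace (𝓡 m) x) : (dirDeriv (mlieBracket (𝓡 m) X Y) f x
      - (dirDeriv X (dirDeriv Y f) x - dirDeriv Y (dirDeriv X f) x)) • v = 0 := by
    obtain ⟨W, hW, rfl⟩ := exists_isSmoothField_eq x v
    have h1 := leibniz_identity_mlieBracket_field hX hY (hW.smul hf) x
    have h2 := leibniz_identity_mlieBracket_field hX hY hW x
    have hXf := contMDiff_dirDeriv hX hf
    have hYf := contMDiff_dirDeriv hY hf
    rw [smulr hW hf, smulr hW hf, smulr hW hf,
      mlieBracket_add_right ((hW.smul hYf).mdifferentiableAt x)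
        (((hY.mlieBracket hW).smul hf).mdifferentiableAt x),
      mlieBracket_add_right ((hW.smul hXf).mdifferentiableAt x)
        (((hX.mlieBracket hW).smul hf).mdifferentiableAt x),
      smulr hW hXf, smulr hW hYf, smulr (hX.mlieBracket hW) hf, smulr (hY.mlieBracket hW) hf] at h1
    simp only [Pi.add_apply, Pi.smul_apply', h2, smul_add] at h1
    rw [← sub_eq_zero] at h1
    rw [← neg_eq_zero, ← h1]
    module
  by_contra hne
  -- A nonzero defect forces the tangent space to be trivial, where all directional derivatives
  -- vanish anyway.
  have h0 (v : TangentSpace (𝓡 m) x) : v = 0 :=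
    (smul_eq_zero.1 (key v)).resolve_left (sub_ne_zero.2 hne)
  apply hne
  simp only [dirDeriv]
  rw [h0 (mlieBracket (𝓡 m) X Y x), h0 (X x), h0 (Y x)]
  simp

end Calculus

/-! ### Levi-Civita connection: metric compatibility and vanishing torsion. -/

namespace SemiRiemannianMetric

variable [IsManifold (𝓡 m) ∞ M] (g : SemiRiemannianMetric m M)
  {X Y Z : Π x : M, TangentSpace (𝓡 m) x}

lemma contMDiff_inner (hX : IsSmoothField X) (hY : IsSmoothField Y) :
    ContMDiff (𝓡 m) 𝓘(ℝ) ∞ (fun y ↦ g.inner y (X y) (Y y)) := by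
  have h : ContMDiff (𝓡 m) ((𝓡 m).prod 𝓘(ℝ)) ∞
      (fun y ↦ TotalSpace.mk' ℝ (E := Bundle.Trivial M ℝ) y (g.inner y (X y) (Y y))) :=
    ContMDiff.clm_bundle_apply₂ (F₁ := EuclideanSpace ℝ (Fin m))
      (F₂ := EuclideanSpace ℝ (Fin m)) g.contMDiff hX hY
  intro y
  exact ((contMDiffAt_totalSpace.1 (h y)).2)

/-- Nondegeneracy, tested on smooth fields only: every tangent vector is the value of one. -/
lemma eq_of_inner_field_eq [T2Space M] {x : M} {v w : TangentSpace (𝓡 m) x}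
    (h : ∀ Z : Π x : M, TangentSpace (𝓡 m) x, IsSmoothField Z →
      g.inner x v (Z x) = g.inner x w (Z x)) : v = w := by
  refine sub_eq_zero.1 (g.nondegenerate x _ fun u ↦ ?_)
  obtain ⟨Z, hZ, rfl⟩ := exists_isSmoothField_eq x u
  simp [h Z hZ]

lemma koszul_field (hX : IsSmoothField X) (hY : IsSmoothField Y) (hZ : IsSmoothField Z) (x : M) :
    2 * g.inner x (g.leviCivita X Y x) (Z x) = g.koszul X Y Z x :=
  g.two_mul_inner_leviCivita (hX.mdifferentiableAt x) (hY.mdifferentiableAt x)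
    (hZ.mdifferentiableAt x)

/-- The Levi-Civita connection is compatible with the metric. -/
lemma dirDeriv_inner (hX : IsSmoothField X) (hY : IsSmoothField Y) (hZ : IsSmoothField Z) (x : M) :
    dirDeriv X (fun y ↦ g.inner y (Y y) (Z y)) x
      = g.inner x (g.leviCivita X Y x) (Z x) + g.inner x (Y x) (g.leviCivita X Z x) := by
  have h1 := g.koszul_field hX hY hZ x
  have h2 := g.koszul_field hX hZ hY x
  have e (V W : Π x : M, TangentSpace (𝓡 m) x) :
      (fun y ↦ g.inner y (V y) (W y)) = fun y ↦ g.inner y (W y) (V y) := by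
    ext y; exact g.symm _ _ _
  simp only [koszul] at h1 h2
  rw [mlieBracket_swap_apply (V := Z) (W := Y), mlieBracket_swap_apply (V := Y) (W := X),
    mlieBracket_swap_apply (V := X) (W := Z), e Z Y, e Y X, e X Z] at h2
  rw [g.symm x (Y x)]
  simp only [map_neg, neg_apply] at h2
  linarith

/-- The Levi-Civita connection is torsion free. -/
lemma leviCivita_sub_leviCivita [T2Space M] (hX : IsSmoothField X) (hY : IsSmoothField Y) (x : M) :
    g.leviCivita X Y x - g.leviCivita Y X x = mlieBracket (𝓡 m) X Y x := by
  refine g.eq_of_inner_field_eq fun Z hZ ↦ ?_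
  have h1 := g.koszul_field hX hY hZ x
  have h2 := g.koszul_field hY hX hZ x
  have e (V W : Π x : M, TangentSpace (𝓡 m) x) :
      (fun y ↦ g.inner y (V y) (W y)) = fun y ↦ g.inner y (W y) (V y) := by
    ext y; exact g.symm _ _ _
  simp only [koszul] at h1 h2
  rw [mlieBracket_swap_apply (V := Y) (W := X), mlieBracket_swap_apply (V := X) (W := Z),
    mlieBracket_swap_apply (V := Z) (W := Y), e X Z, e Z Y, e Y X] at h2
  simp only [map_neg, neg_apply] at h2
  rw [map_sub, sub_apply]
  linarith

/-- Follows from metric compatibility. It is needed to differentiate `∇ξ = -φ` once more in the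
curvature. -/
lemma leviCivita_neg [T2Space M] (hX : IsSmoothField X) (hY : IsSmoothField Y) (x : M) :
    g.leviCivita X (-Y) x = -g.leviCivita X Y x := by
  refine g.eq_of_inner_field_eq fun Z hZ ↦ ?_
  have h1 := g.dirDeriv_inner hX hY hZ x
  have h2 := g.dirDeriv_inner hX hY.neg hZ x
  have e : (fun y ↦ g.inner y ((-Y) y) (Z y)) = -fun y ↦ g.inner y (Y y) (Z y) := by
    ext y; simp
  rw [e, dirDeriv_neg] at h2
  simp only [Pi.neg_apply, map_neg, neg_apply] at h2 ⊢
  linarith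

end SemiRiemannianMetric

end SemiRiemannian

end ParacontactGeometry

namespace ParacontactGeometry

section Paracontact

variable {n : ℕ} {M : Type*} [TopologicalSpace M]
  [ChartedSpace (EuclideanSpace ℝ (Fin (2 * n + 1))) M] [IsManifold (𝓡 (2 * n + 1)) ∞ M]

/-! ### Pointwise algebra of `(φ, ξ, η)`. -/

namespace AlmostParacontactStructure

variable (S : AlmostParacontactStructure n M) {X : Π x : M, TangentSpace (𝓡 (2 * n + 1)) x}

lemma ξ_ne_zero (x : M) : S.ξ x ≠ 0 := fun h ↦ by simpa [h] using S.η_ξ x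

/-- From `φ²ξ = 0`, applying `φ² = I - η ⊗ ξ` to `φξ` gives `φξ = cξ` with `c = η(φξ)`; then `c²ξ =
φ²ξ = 0`. -/
lemma φ_ξ (x : M) : S.φ x (S.ξ x) = 0 := by
  have h1 : S.φ x (S.φ x (S.ξ x)) = 0 := by simp [S.φ_φ, S.η_ξ]
  have h2 := S.φ_φ x (S.φ x (S.ξ x))
  rw [h1, map_zero, eq_comm, sub_eq_zero] at h2
  generalize S.η x (S.φ x (S.ξ x)) = c at h2
  rw [h2, map_smul, h2, smul_smul, smul_eq_zero, or_iff_left (S.ξ_ne_zero x),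
    mul_self_eq_zero] at h1
  rw [h2, h1, zero_smul]

/-- Compare the two ways of expanding `φ³v`, as `φ(φ²v)` and as `φ²(φv)`. -/
lemma η_φ (x : M) (v : TangentSpace (𝓡 (2 * n + 1)) x) : S.η x (S.φ x v) = 0 := by
  have h1 := S.φ_φ x (S.φ x v)
  rw [S.φ_φ x v, map_sub, map_smul, S.φ_ξ, smul_zero, sub_zero, eq_comm, sub_eq_self] at h1
  exact (smul_eq_zero.1 h1).resolve_right (S.ξ_ne_zero x)

lemma phi_field (hX : IsSmoothField X) : IsSmoothField (S.phi X) :=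
  ContMDiff.clm_bundle_apply (F₁ := EuclideanSpace ℝ (Fin (2 * n + 1)))
    (F₂ := EuclideanSpace ℝ (Fin (2 * n + 1))) S.contMDiff_φ hX

end AlmostParacontactStructure

/-! ### Lie derivatives along `ξ`, the tensor `h`, and the covariant derivative of `φ`. -/

namespace ParacontactMetricStructure

variable (S : ParacontactMetricStructure n M) {X Y Z : Π x : M, TangentSpace (𝓡 (2 * n + 1)) x}

lemma inner_ξ (x : M) (v : TangentSpace (𝓡 (2 * n + 1)) x) : S.g.inner x v (S.ξ x) = S.η x v := by
  have h := S.compatible x v (S.ξ x)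
  rw [S.φ_ξ, map_zero, S.η_ξ] at h
  linarith

lemma inner_φ_left (x : M) (v w : TangentSpace (𝓡 (2 * n + 1)) x) :
    S.g.inner x (S.φ x v) w = -S.g.inner x v (S.φ x w) := by
  have h := S.compatible x v (S.φ x w)
  rw [S.η_φ, S.φ_φ, map_sub, map_smul, S.inner_ξ, S.η_φ] at h
  simpa using h

lemma contMDiff_η_field (hX : IsSmoothField X) :
    ContMDiff (𝓡 (2 * n + 1)) 𝓘(ℝ) ∞ (fun y ↦ S.η y (X y)) := by
  simpa only [S.inner_ξ] using S.g.contMDiff_inner hX S.contMDiff_ξ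

/-- The Lie derivative `L_ξ η` vanishes. -/
lemma η_mlieBracket_ξ (hX : IsSmoothField X) (x : M) :
    S.η x (mlieBracket (𝓡 (2 * n + 1)) S.ξ X x) = dirDeriv S.ξ (fun y ↦ S.η y (X y)) x := by
  have h := S.dη_eq S.ξ X S.contMDiff_ξ hX x
  rw [S.g.symm, S.inner_ξ, S.η_φ, AlmostParacontactStructure.dη] at h
  simp only [S.η_ξ, dirDeriv_const] at h
  linarith

/-- The exterior derivative `dη` in terms of the metric. -/
lemma η_mlieBracket (hX : IsSmoothField X) (hY : IsSmoothField Y) (x : M) :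
    S.η x (mlieBracket (𝓡 (2 * n + 1)) X Y x) = dirDeriv X (fun y ↦ S.η y (Y y)) x
      - dirDeriv Y (fun y ↦ S.η y (X y)) x - 2 * S.g.inner x (X x) (S.φ x (Y x)) := by
  rw [← S.dη_eq X Y hX hY, AlmostParacontactStructure.dη]
  ring

/-- The Lie derivative `L_ξ dη` vanishes. -/
lemma dirDeriv_ξ_inner_φ [T2Space M] (hX : IsSmoothField X) (hY : IsSmoothField Y) (x : M) :
    dirDeriv S.ξ (fun y ↦ S.g.inner y (X y) (S.φ y (Y y))) x
      = S.g.inner x (mlieBracket (𝓡 (2 * n + 1)) S.ξ X x) (S.φ x (Y x))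
        + S.g.inner x (X x) (S.φ x (mlieBracket (𝓡 (2 * n + 1)) S.ξ Y x)) := by
  have hξ := S.contMDiff_ξ
  have hηX := S.contMDiff_η_field hX
  have hηY := S.contMDiff_η_field hY
  have hXY := hX.mlieBracket hY
  have hξX := hξ.mlieBracket hX
  have hξY := hξ.mlieBracket hY
  have md {f : M → ℝ} (hf : ContMDiff (𝓡 (2 * n + 1)) 𝓘(ℝ) ∞ f) :
      MDifferentiableAt (𝓡 (2 * n + 1)) 𝓘(ℝ) f x := (hf x).mdifferentiableAt (by simp)
  have hF := S.g.contMDiff_inner hX (S.phi_field hY)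
  have e : (fun y ↦ S.η y (mlieBracket (𝓡 (2 * n + 1)) X Y y))
      + ((fun y ↦ S.g.inner y (X y) (S.phi Y y)) + fun y ↦ S.g.inner y (X y) (S.phi Y y))
      = dirDeriv X (fun y ↦ S.η y (Y y)) - dirDeriv Y (fun y ↦ S.η y (X y)) := by
    ext y
    simp only [Pi.add_apply, Pi.sub_apply, S.η_mlieBracket hX hY,
      AlmostParacontactStructure.phi]
    ring
  -- Differentiate the formula for `2 dη(X, Y)` along `ξ`. By `L_ξ η = 0`, the Jacobi identity and
  -- the commutator formula, the result is the sum of the same formula for `([ξ, X], Y)` and for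
  -- `(X, [ξ, Y])`.
  have h1 := congrArg (fun f ↦ dirDeriv S.ξ f x) e
  rw [dirDeriv_add x (md (S.contMDiff_η_field hXY)) (md (hF.add hF)), dirDeriv_add x (md hF) (md hF),
    dirDeriv_sub x (md (contMDiff_dirDeriv hX hηY)) (md (contMDiff_dirDeriv hY hηX)),
    ← S.η_mlieBracket_ξ hXY, leibniz_identity_mlieBracket_field hξ hX hY, map_add,
    S.η_mlieBracket hξX hY, S.η_mlieBracket hX hξY, dirDeriv_mlieBracket hξ hX hηY,
    dirDeriv_mlieBracket hξ hY hηX, funext (S.η_mlieBracket_ξ hX),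
    funext (S.η_mlieBracket_ξ hY)] at h1
  change dirDeriv S.ξ (fun y ↦ S.g.inner y (X y) (S.phi Y y)) x = _
  linarith

/-- The Lie derivative `L_ξ g` in terms of `h`. -/
lemma lieDeriv_inner_phi [T2Space M] (hX : IsSmoothField X) (hY : IsSmoothField Y) (x : M) :
    dirDeriv S.ξ (fun y ↦ S.g.inner y (X y) (S.phi Y y)) x
      - S.g.inner x (mlieBracket (𝓡 (2 * n + 1)) S.ξ X x) (S.phi Y x)
      - S.g.inner x (X x) (mlieBracket (𝓡 (2 * n + 1)) S.ξ (S.phi Y) x)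
      = -2 * S.g.inner x (X x) (S.h Y x) := by
  have h := S.dirDeriv_ξ_inner_φ hX hY x
  simp only [AlmostParacontactStructure.h, map_smul, map_sub, smul_eq_mul]
  change dirDeriv S.ξ (fun y ↦ S.g.inner y (X y) (S.phi Y y)) x
    = S.g.inner x _ (S.phi Y x) + _ at h
  linarith

lemma h_eq_zero_of_isKilling [T2Space M] (hK : S.g.IsKilling S.ξ) (hX : IsSmoothField X) (x : M) :
    S.h X x = 0 := by
  refine S.g.eq_of_inner_field_eq fun Z hZ ↦ ?_
  have h := S.lieDeriv_inner_phi hZ hX x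
  rw [hK Z _ hZ (S.phi_field hX)] at h
  rw [S.g.symm]
  simp only [map_zero, zero_apply]
  linarith

/-- `h = 0` kills `L_ξ g` when one argument lies in the image of `φ`. Splitting `Y = φ(φY) + η(Y)ξ`,
the remaining part is `(L_ξ g)(X, η(Y)ξ) = η(Y)(L_ξ η)(X) = 0`. -/
lemma isKilling_of_h_eq_zero [T2Space M]
    (h0 : ∀ X : Π x : M, TangentSpace (𝓡 (2 * n + 1)) x, IsSmoothField X → ∀ x, S.h X x = 0) :
    S.g.IsKilling S.ξ := by
  intro X Y hX hY x
  have hξ := S.contMDiff_ξ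
  have hη := S.contMDiff_η_field hY
  have hηX := S.contMDiff_η_field hX
  have md {f : M → ℝ} (hf : ContMDiff (𝓡 (2 * n + 1)) 𝓘(ℝ) ∞ f) :
      MDifferentiableAt (𝓡 (2 * n + 1)) 𝓘(ℝ) f x := (hf x).mdifferentiableAt (by simp)
  have hφ := S.phi_field (S.phi_field hY)
  have hs := IsSmoothField.smul hη hξ
  have e : Y = S.phi (S.phi Y) + (fun y ↦ S.η y (Y y)) • S.ξ := by
    ext1 y
    simp [AlmostParacontactStructure.phi, S.φ_φ]
  have h1 := S.lieDeriv_inner_phi hX (S.phi_field hY) x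
  rw [h0 _ (S.phi_field hY)] at h1
  have e1 : (fun y ↦ S.g.inner y (X y) (Y y))
      = (fun y ↦ S.g.inner y (X y) (S.phi (S.phi Y) y))
        + (fun y ↦ S.η y (Y y)) * fun y ↦ S.η y (X y) := by
    ext y
    conv_lhs => rw [congrFun e y]
    simp [S.inner_ξ]
  have e2 : mlieBracket (𝓡 (2 * n + 1)) S.ξ Y x
      = mlieBracket (𝓡 (2 * n + 1)) S.ξ (S.phi (S.phi Y)) x
        + dirDeriv S.ξ (fun y ↦ S.η y (Y y)) x • S.ξ x := by
    conv_lhs => rw [e]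
    rw [mlieBracket_add_right (hφ.mdifferentiableAt x) (hs.mdifferentiableAt x),
      mlieBracket_smul_right (md hη) (hξ.mdifferentiableAt x), mlieBracket_self]
    simp [dirDeriv]
  have e3 : dirDeriv S.ξ ((fun y ↦ S.η y (Y y)) * fun y ↦ S.η y (X y)) x
      = S.η x (Y x) * dirDeriv S.ξ (fun y ↦ S.η y (X y)) x
        + S.η x (X x) * dirDeriv S.ξ (fun y ↦ S.η y (Y y)) x := by
    simp [dirDeriv, mvfderiv_mul (md hη) (md hηX)]
  have e4 : S.g.inner x (mlieBracket (𝓡 (2 * n + 1)) S.ξ X x) (Y x)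
      = S.g.inner x (mlieBracket (𝓡 (2 * n + 1)) S.ξ X x) (S.phi (S.phi Y) x)
        + S.η x (Y x) * dirDeriv S.ξ (fun y ↦ S.η y (X y)) x := by
    conv_lhs => rw [congrFun e x]
    simp [S.inner_ξ, S.η_mlieBracket_ξ hX]
  rw [e1, e2, e4, dirDeriv_add x (md (S.g.contMDiff_inner hX hφ)) (md (hη.mul hηX)), e3,
    map_add, map_smul, S.inner_ξ]
  simp only [map_zero, mul_zero, smul_eq_mul] at h1 ⊢
  linarith

/-- On `(ξ, X)` the term `dη(ξ, X)` vanishes and the Nijenhuis tensor is `-2φ(hX)`. Also `η(hX) = 0`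
by `L_ξ η = 0`, so `hX = φ²(hX) + η(hX)ξ = 0`. -/
lemma h_eq_zero_of_isParaSasakian (hN : S.IsParaSasakian) (hX : IsSmoothField X) (x : M) :
    S.h X x = 0 := by
  have hξ := S.contMDiff_ξ
  have h1 := hN S.ξ X hξ hX x
  have hφξ : S.phi S.ξ = 0 := by
    ext1 y
    exact S.φ_ξ y
  rw [S.dη_eq _ _ hξ hX, S.g.symm, S.inner_ξ, S.η_φ, AlmostParacontactStructure.nijenhuis, hφξ,
    mlieBracket_zero_left, mlieBracket_zero_left] at h1
  have h2 : S.φ x (S.h X x) = 0 := by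
    simp only [AlmostParacontactStructure.h, map_smul, map_sub]
    simp only [Pi.zero_apply, map_zero, mul_zero, zero_smul, add_zero, sub_zero] at h1
    rw [← neg_sub, h1]
    simp
  have h3 : S.η x (S.h X x) = 0 := by
    have : (fun y ↦ S.η y (S.phi X y)) = fun _ ↦ 0 := by
      ext y
      exact S.η_φ y (X y)
    simp [AlmostParacontactStructure.h, S.η_mlieBracket_ξ (S.phi_field hX), this, S.η_φ,
      dirDeriv_const]
  have h4 := S.φ_φ x (S.h X x)
  rw [h2, h3] at h4
  simpa using h4.symm

/-- On a K-paracontact manifold `∇_X ξ = -φ X`. -/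
lemma leviCivita_ξ [T2Space M] (hK : S.g.IsKilling S.ξ) (hX : IsSmoothField X) :
    S.g.leviCivita X S.ξ = -S.phi X := by
  ext1 x
  refine S.g.eq_of_inner_field_eq fun Z hZ ↦ ?_
  -- The Koszul formula reads `2g(∇_X ξ, Z) = (L_ξ g)(X, Z) + 2dη(X, Z)`, and `dη(X, Z) = g(X, φZ) =
  -- -g(φX, Z)`.
  have h1 := S.g.koszul_field hX S.contMDiff_ξ hZ x
  have h2 := hK Z X hZ hX x
  have h3 := S.η_mlieBracket hX hZ x
  have h4 := S.inner_φ_left x (X x) (Z x)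
  simp only [SemiRiemannianMetric.koszul, S.inner_ξ, S.g.symm _ (S.ξ _)] at h1
  rw [mlieBracket_swap_apply (V := X) (W := S.ξ), mlieBracket_swap_apply (V := Z) (W := X)] at h1
  simp only [map_neg, neg_apply, Pi.neg_apply, AlmostParacontactStructure.phi] at h1 ⊢
  rw [S.g.symm x (Z x)] at h2
  linarith

/-- A K-paracontact manifold with `R(X, Y) ξ = -(η(Y) X - η(X) Y)` satisfies
`(∇_X φ) Y = -g(X, Y) ξ + η(Y) X`. -/
lemma leviCivita_phi [T2Space M] (hK : S.g.IsKilling S.ξ)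
    (hR : ∀ X Y : Π x : M, TangentSpace (𝓡 (2 * n + 1)) x, IsSmoothField X → IsSmoothField Y →
      ∀ x, S.g.curvature X Y S.ξ x = -(S.η x (Y x) • X x - S.η x (X x) • Y x))
    (hX : IsSmoothField X) (hY : IsSmoothField Y) (x : M) :
    S.g.leviCivita X (S.phi Y) x = S.φ x (S.g.leviCivita X Y x)
      - S.g.inner x (X x) (Y x) • S.ξ x + S.η x (Y x) • X x := by
  -- By `∇ξ = -φ` and vanishing torsion, `R(X, Y)ξ = (∇_Y φ)X - (∇_X φ)Y`; so the assumption says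
  -- that `(∇_X φ)Y - η(Y)X` is symmetric in `X, Y`.
  have symm {X Y : Π x : M, TangentSpace (𝓡 (2 * n + 1)) x} (hX : IsSmoothField X)
      (hY : IsSmoothField Y) : S.g.leviCivita X (S.phi Y) x - S.φ x (S.g.leviCivita X Y x)
        - S.η x (Y x) • X x = S.g.leviCivita Y (S.phi X) x - S.φ x (S.g.leviCivita Y X x)
          - S.η x (X x) • Y x := by
    have h := hR X Y hX hY x
    rw [SemiRiemannianMetric.curvature, S.leviCivita_ξ hK hX, S.leviCivita_ξ hK hY,
      S.leviCivita_ξ hK (hX.mlieBracket hY), S.g.leviCivita_neg hX (S.phi_field hY),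
      S.g.leviCivita_neg hY (S.phi_field hX), Pi.neg_apply, AlmostParacontactStructure.phi,
      ← S.g.leviCivita_sub_leviCivita hX hY, map_sub, ← sub_eq_zero] at h
    rw [← sub_eq_zero, ← neg_eq_zero, ← h]
    module
  -- `∇_X φ` is skew for `g` because `φ` is and `∇g = 0`.
  have skew {X Y Z : Π x : M, TangentSpace (𝓡 (2 * n + 1)) x} (hX : IsSmoothField X)
      (hY : IsSmoothField Y) (hZ : IsSmoothField Z) :
      S.g.inner x (S.g.leviCivita X (S.phi Y) x - S.φ x (S.g.leviCivita X Y x)) (Z x)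
        = -S.g.inner x (S.g.leviCivita X (S.phi Z) x - S.φ x (S.g.leviCivita X Z x)) (Y x) := by
    have h1 := S.g.dirDeriv_inner hX (S.phi_field hY) hZ x
    have h2 := S.g.dirDeriv_inner hX (S.phi_field hZ) hY x
    have e : (fun y ↦ S.g.inner y (S.phi Y y) (Z y))
        = -fun y ↦ S.g.inner y (S.phi Z y) (Y y) := by
      ext y
      rw [Pi.neg_apply, S.g.symm y (S.phi Z y)]
      exact S.inner_φ_left y (Y y) (Z y)
    rw [e, dirDeriv_neg] at h1
    simp only [map_sub, sub_apply, S.inner_φ_left]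
    simp only [AlmostParacontactStructure.phi, S.inner_φ_left] at h1 h2 ⊢
    rw [S.g.symm x (Y x)] at h1
    rw [S.g.symm x (Z x)] at h2
    rw [S.inner_φ_left] at h1 h2
    linarith
  refine S.g.eq_of_inner_field_eq fun Z hZ ↦ ?_
  have inner_symm {X Y : Π x : M, TangentSpace (𝓡 (2 * n + 1)) x} (hX : IsSmoothField X)
      (hY : IsSmoothField Y) (Z : TangentSpace (𝓡 (2 * n + 1)) x) :
      S.g.inner x (S.g.leviCivita X (S.phi Y) x - S.φ x (S.g.leviCivita X Y x)) Z
        - S.η x (Y x) * S.g.inner x (X x) Z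
        = S.g.inner x (S.g.leviCivita Y (S.phi X) x - S.φ x (S.g.leviCivita Y X x)) Z
          - S.η x (X x) * S.g.inner x (Y x) Z := by
    simpa using congrArg (fun v ↦ S.g.inner x v Z) (symm hX hY)
  -- A trilinear form symmetric in its first two arguments and skew in its last two vanishes. The
  -- same cyclic argument, carrying the `η` terms along, determines `g((∇_X φ)Y, Z)`.
  have h1 := inner_symm hX hY (Z x)
  have h2 := inner_symm hY hZ (X x)
  have h3 := inner_symm hZ hX (Y x)
  have h4 := skew hX hY hZ
  have h5 := skew hY hZ hX
  have h6 := skew hZ hX hY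
  rw [S.g.symm x (Z x)] at h2 h3
  rw [S.g.symm x (Y x) (X x)] at h2
  have h7 : S.g.inner x (S.g.leviCivita X (S.phi Y) x - S.φ x (S.g.leviCivita X Y x)) (Z x)
      = S.η x (Y x) * S.g.inner x (X x) (Z x) - S.g.inner x (X x) (Y x) * S.η x (Z x) := by
    linarith
  simp only [map_sub, map_add, map_smul, sub_apply, add_apply, smul_apply, smul_eq_mul,
    S.g.symm x (S.ξ x), S.inner_ξ] at h7 ⊢
  linarith

/-- Write all brackets through `∇` and insert the formula for `∇φ`: the derivative terms cancel, and
what is left of the Nijenhuis tensor is `2g(X, φY)ξ = 2dη(X, Y)ξ`. -/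
lemma isParaSasakian_of_isKilling [T2Space M] (hK : S.g.IsKilling S.ξ)
    (hR : ∀ X Y : Π x : M, TangentSpace (𝓡 (2 * n + 1)) x, IsSmoothField X → IsSmoothField Y →
      ∀ x, S.g.curvature X Y S.ξ x = -(S.η x (Y x) • X x - S.η x (X x) • Y x)) :
    S.IsParaSasakian := by
  intro X Y hX hY x
  have hφX := S.phi_field hX
  have hφY := S.phi_field hY
  rw [S.dη_eq _ _ hX hY, AlmostParacontactStructure.nijenhuis,
    ← S.g.leviCivita_sub_leviCivita hX hY, ← S.g.leviCivita_sub_leviCivita hφX hφY,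
    ← S.g.leviCivita_sub_leviCivita hφX hY, ← S.g.leviCivita_sub_leviCivita hX hφY,
    S.leviCivita_phi hK hR hφX hY, S.leviCivita_phi hK hR hφY hX, S.leviCivita_phi hK hR hX hY,
    S.leviCivita_phi hK hR hY hX]
  simp only [AlmostParacontactStructure.phi, map_sub, map_add, map_smul, S.φ_ξ, S.inner_φ_left,
    S.g.symm x (Y x)]
  module

end ParacontactMetricStructure

end Paracontact

end ParacontactGeometry

theorem theorem3p1 (n : ℕ) (M : Type*) [TopologicalSpace M] [T2Space M]
    [ChartedSpace (EuclideanSpace ℝ (Fin (2 * n + 1))) M] [IsManifold (𝓡 (2 * n + 1)) ∞ M]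
    (S : ParacontactGeometry.ParacontactMetricStructure n M)
    (hR : ∀ X Y : Π x : M, TangentSpace (𝓡 (2 * n + 1)) x,
      ParacontactGeometry.IsSmoothField X → ParacontactGeometry.IsSmoothField Y → ∀ x : M,
        S.g.curvature X Y S.ξ x = -(S.η x (Y x) • X x - S.η x (X x) • Y x)) :
    (S.IsParaSasakian ↔ S.g.IsKilling S.ξ) ∧
    (S.g.IsKilling S.ξ ↔
      ∀ X : Π x : M, TangentSpace (𝓡 (2 * n + 1)) x,
        ParacontactGeometry.IsSmoothField X → ∀ x : M, S.h X x = 0) := by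
  refine ⟨⟨fun hN ↦ ?_, fun hK ↦ S.isParaSasakian_of_isKilling hK hR⟩,
    fun hK X hX x ↦ S.h_eq_zero_of_isKilling hK hX x, S.isKilling_of_h_eq_zero⟩
  exact S.isKilling_of_h_eq_zero fun X hX x ↦ S.h_eq_zero_of_isParaSasakian hN hX x
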